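/- Let $r,N\ge 0$ be integers and let $\lambda=(\lambda_1\ge\cdots\ge\lambda_r\ge 0)$ be a partition (with zero parts allowed) such that $\lambda_1\le N$. For $j\ge 0$ let $m_j$ be the number of indices $i$ with $\lambda_i=j$. **The model.** Consider the rectangular grid with $r$ rows, numbered $1,\dots,r$ from top to bottom, and $N+1$ columns, numbered $0,\dots,N$ from right to left. Horizontal edges carry spins in $\{+,-\}$ and vertical edges carry spins in $\mathbb{N}=\{0,1,2,\dots\}$. The boundary spins are: $+$ on every left edge, $-$ on every right edge, $m_j$ on the top edge of column $j$, and $0$ on every bottom edge. A state of the system $\mathfrak{S}_\lambda(\mathbf z;t)$ is an assignment of spins to all edges with these boundary values. The local weight of a vertex in row $i$ depends on its (left, top, right, bottom) spins and is, for $n\ge 0$, | (left, top, right, bottom) | $(+,n,+,n)$ | $(-,n,-,n)$ | $(-,n,+,n+1)$ | $(+,n+1,-,n)$ | |---|---|---|---|---| | $P$-weight | $1$ | $z_i$ | $z_i(1-t^{n+1})$ | $1$ | | $R$-weight | $1$ | $z_i$ | $z_i(1-t)$ | $\frac{1-t^{n+1}}{1-t}=1+t+\cdots+t^n$ | and $0$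 for every other configuration. The weight of a state is the product of the local weights of all vertices, and $Z_P(\mathfrak{S}_\lambda(\mathbf z;t))$, $Z_R(\mathfrak{S}_\lambda(\mathbf z;t))$ are the sums over all states of the weights formed with the $P$-weights and the $R$-weights, respectively (only finitely many states have nonzero weight). **Hall–Littlewood polynomials.** In the field of rational functions in indeterminates $z_1,\dots,z_r,t$ put $$R_\lambda(\mathbf z;t)=\sum_{w\in S_r} w\Bigl(z_1^{\lambda_1}\cdots z_r^{\lambda_r}\prod_{i<j}\frac{z_i-tz_j}{z_i-z_j}\Bigr),\qquad P_\lambda(\mathbf z;t)=\frac{R_\lambda(\mathbf z;t)}{v_\lambda(t)},\qquad v_\lambda(t)=\prod_{j\ge 0}\prod_{i=1}^{m_j}\frac{1-t^i}{1-t},$$ where $w$ acts by permuting $z_1,\dots,z_r$. **Theorem.** As rational functions in the indeterminates $z_1,\dots,z_r,t$, $$Z_P(\mathfrak{S}_\lambda(\mathbf z;t))=P_\lambda(z_1,\dots,z_r;t),\qquad Z_R(\mathfrak{S}_\lambda(\mathbf z;t))=R_\lambda(z_1,\dots,z_r;t).$$ Moreover $P_\lambda$ and $R_\lambda$ are polynomials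 in $z_1,\dots,z_r,t$ with integer coefficients, and both identities hold for all values of $z_1,\dots,z_r,t$ in any commutative ring (in particular, in $\mathbb{C}$). -/

import Mathlib

namespace BosonicModel

open Polynomial

/-- Spins of horizontal edges. -/
inductive HSpin
  | plus
  | minus
  deriving DecidableEq

instance : Fintype HSpin where
  elems := {.plus, .minus}
  complete := by intro x; cases x <;> simp

/-- The polynomial `(1 - t ^ n) / (1 - t) = 1 + t + ⋯ + t ^ (n - 1)`, which makes sense for every
value of `t`, including `t = 1`. -/
def qInt {K : Type*} [CommRing K] (t : K) (n : ℕ) : K :=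
  ∑ i ∈ Finset.range n, t ^ i

theorem qInt_eq_div {K : Type*} [Field K] {t : K} (ht : t ≠ 1) (n : ℕ) :
    qInt t n = (1 - t ^ n) / (1 - t) := by
  have h : (1 : K) - t ≠ 0 := sub_ne_zero.mpr (Ne.symm ht)
  rw [eq_div_iff h, qInt, mul_comm, mul_neg_geom_sum]

/-- The `P`-weight of a vertex with parameter `z`, given the spins of its left, top, right and
bottom edges. The four cases are the patterns `A(n)`, `B(n)`, `C(n)`, `D(n)`; every other
configuration has weight zero. -/
def weightP {K : Type*} [CommRing K] (t z : K) (left : HSpin) (top : ℕ) (right : HSpin)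
    (bottom : ℕ) : K :=
  match left, right with
  | .plus, .plus => if bottom = top then 1 else 0
  | .minus, .minus => if bottom = top then z else 0
  | .minus, .plus => if bottom = top + 1 then z * (1 - t ^ (top + 1)) else 0
  | .plus, .minus => if top = bottom + 1 then 1 else 0

/-- The `R`-weight of a vertex with parameter `z`. -/
def weightR {K : Type*} [CommRing K] (t z : K) (left : HSpin) (top : ℕ) (right : HSpin)
    (bottom : ℕ) : K :=
  match left, right with
  | .plus, .plus => if bottom = top then 1 else 0
  | .minus, .minus => if bottom = top then z else 0
  | .minus, .plus => if bottom = top + 1 then z * (1 - t) else 0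
  | .plus, .minus => if top = bottom + 1 then qInt t (bottom + 1) else 0

/-- The number `m_j` of parts of `lam` equal to `j`. -/
def mult {r : ℕ} (lam : Fin r → ℕ) (j : ℕ) : ℕ :=
  (Finset.univ.filter fun i => lam i = j).card

/-- A state of the uncolored system attached to `lam` on a grid with `r` rows, numbered from top
to bottom, and columns `0, …, N`, numbered from right to left.
* `h i k` is the spin of the `k`-th horizontal edge of row `i`, counted from the right: the vertex
  in row `i` and column `j` lies between the edges `j + 1` (on its left) and `j` (on its right).
* `v k j` is the spin of the `k`-th vertical edge of column `j`, counted from the top: the vertex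
  in row `i` and column `j` lies between the edges `i` (above) and `i + 1` (below). -/
@[ext]
structure State (r N : ℕ) (lam : Fin r → ℕ) where
  h : Fin r → Fin (N + 2) → HSpin
  v : Fin (r + 1) → Fin (N + 1) → ℕ
  left_boundary : ∀ i, h i (Fin.last (N + 1)) = .plus
  right_boundary : ∀ i, h i 0 = .minus
  top_boundary : ∀ j, v 0 j = mult lam j
  bottom_boundary : ∀ j, v (Fin.last r) j = 0

/-- The Boltzmann weight of a state: the product of the local weights of all vertices, where `w`
is a system of local weights and `z i` is the parameter of the vertices in row `i`. -/
def State.weight {r N : ℕ} {lam : Fin r → ℕ} {K : Type*} [CommRing K]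
    (w : K → HSpin → ℕ → HSpin → ℕ → K) (z : Fin r → K) (s : State r N lam) : K :=
  ∏ i : Fin r, ∏ j : Fin (N + 1),
    w (z i) (s.h i j.succ) (s.v i.castSucc j) (s.h i j.castSucc) (s.v i.succ j)

/-- The partition function: the sum of the Boltzmann weights of all states. Only finitely many of
them are nonzero for the `P`- and `R`-weights (`finite_support_weightP`,
`finite_support_weightR`). -/
noncomputable def partitionFunction {r : ℕ} (N : ℕ) (lam : Fin r → ℕ) {K : Type*} [CommRing K]
    (w : K → HSpin → ℕ → HSpin → ℕ → K) (z : Fin r → K) : K :=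
  ∑ᶠ s : State r N lam, s.weight w z

/-- The partition function `Z_P` for the `P`-weights. -/
noncomputable def ZP {r : ℕ} (N : ℕ) (lam : Fin r → ℕ) {K : Type*} [CommRing K]
    (z : Fin r → K) (t : K) : K :=
  partitionFunction N lam (weightP t) z

/-- The partition function `Z_R` for the `R`-weights. -/
noncomputable def ZR {r : ℕ} (N : ℕ) (lam : Fin r → ℕ) {K : Type*} [CommRing K]
    (z : Fin r → K) (t : K) : K :=
  partitionFunction N lam (weightR t) z

theorem finite_support_weight {r N : ℕ} {lam : Fin r → ℕ} {K : Type*} [CommRing K]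
    (w : K → HSpin → ℕ → HSpin → ℕ → K) (z : Fin r → K)
    (hw : ∀ x a b c d, w x a b c d ≠ 0 → d ≤ b + 1) :
    (Function.support fun s : State r N lam => s.weight w z).Finite := by
  classical
  let f : State r N lam → (Fin r → Fin (N + 2) → HSpin) × (Fin (r + 1) → Fin (N + 1) → ℕ) :=
    fun s => (s.h, s.v)
  have hf : Function.Injective f := by
    intro s s' e
    exact State.ext (congrArg Prod.fst e) (congrArg Prod.snd e)
  refine Set.Finite.of_finite_image (f := f) ?_ hf.injOn
  have hfin : ((Set.univ : Set (Fin r → Fin (N + 2) → HSpin)) ×ˢ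
      (Set.Iic fun (_ : Fin (r + 1)) (_ : Fin (N + 1)) => r + r)).Finite :=
    Set.finite_univ.prod (Set.finite_Iic _)
  refine hfin.subset ?_
  rintro _ ⟨s, hs, rfl⟩
  refine ⟨Set.mem_univ _, ?_⟩
  have hs' : s.weight w z ≠ 0 := hs
  have hstep : ∀ (i : Fin r) (j : Fin (N + 1)), s.v i.succ j ≤ s.v i.castSucc j + 1 := by
    intro i j
    refine hw (z i) (s.h i j.succ) _ (s.h i j.castSucc) _ fun h0 => hs' ?_
    exact Finset.prod_eq_zero (Finset.mem_univ i) (Finset.prod_eq_zero (Finset.mem_univ j) h0)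
  have hb : ∀ (k : Fin (r + 1)) (j : Fin (N + 1)), s.v k j ≤ r + k := by
    intro k j
    induction k using Fin.induction with
    | zero =>
      rw [s.top_boundary j]
      have := Finset.card_filter_le (Finset.univ : Finset (Fin r)) fun i => lam i = j
      simpa [mult] using this
    | succ i ih =>
      have := hstep i j
      simp only [Fin.val_castSucc, Fin.val_succ] at ih ⊢
      omega
  intro k j
  have := hb k j
  have := k.is_lt
  change s.v k j ≤ r + r
  omega

theorem finite_support_weightP {r N : ℕ} {lam : Fin r → ℕ} {K : Type*} [CommRing K]
    (z : Fin r → K) (t : K) :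
    (Function.support fun s : State r N lam => s.weight (weightP t) z).Finite := by
  refine finite_support_weight _ z fun x a b c d h => ?_
  cases a <;> cases c <;> simp only [weightP, ne_eq, ite_eq_right_iff, Classical.not_imp] at h <;>
    omega

theorem finite_support_weightR {r N : ℕ} {lam : Fin r → ℕ} {K : Type*} [CommRing K]
    (z : Fin r → K) (t : K) :
    (Function.support fun s : State r N lam => s.weight (weightR t) z).Finite := by
  refine finite_support_weight _ z fun x a b c d h => ?_
  cases a <;> cases c <;> simp only [weightR, ne_eq, ite_eq_right_iff, Classical.not_imp] at h <;>
    omega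

/-- `∑_{w ∈ S_r} w (z^lam ∏_{i < j} (z_i - t z_j) / (z_i - z_j))`, where `w` permutes the `z_i`. -/
noncomputable def hallLittlewoodSum {r : ℕ} (lam : Fin r → ℕ) {K : Type*} [Field K]
    (z : Fin r → K) (t : K) : K :=
  ∑ w : Equiv.Perm (Fin r),
    (∏ i, z (w i) ^ lam i) *
      ∏ i, ∏ j ∈ Finset.Ioi i, (z (w i) - t * z (w j)) / (z (w i) - z (w j))

/-- `v_m(t) = ∏_{i = 1}^m (1 - t^i) / (1 - t)`. -/
noncomputable def vNum {K : Type*} [Field K] (t : K) (m : ℕ) : K :=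
  ∏ i ∈ Finset.Icc 1 m, (1 - t ^ i) / (1 - t)

/-- `v_lam(t) = ∏_j v_{m_j}(t)`, the product being over all `j ≥ 0` that occur in `lam` (the other
factors are `1`). -/
noncomputable def vLam {r : ℕ} (lam : Fin r → ℕ) {K : Type*} [Field K] (t : K) : K :=
  ∏ j ∈ Finset.univ.image lam, vNum t (mult lam j)

/-- The field of rational functions in indeterminates `z_1, …, z_r` and `t`. -/
abbrev RatField (r : ℕ) : Type := FractionRing (MvPolynomial (Fin r) ℤ[X])

/-- The indeterminate `z_i` in the field of rational functions. -/
noncomputable def genZ (r : ℕ) (i : Fin r) : RatField r :=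
  algebraMap (MvPolynomial (Fin r) ℤ[X]) (RatField r) (MvPolynomial.X i)

/-- The indeterminate `t` in the field of rational functions. -/
noncomputable def genT (r : ℕ) : RatField r :=
  algebraMap (MvPolynomial (Fin r) ℤ[X]) (RatField r) (MvPolynomial.C X)

/-- The Hall–Littlewood function `R_lam(z; t)`, a priori a rational function. -/
noncomputable def hallLittlewoodR {r : ℕ} (lam : Fin r → ℕ) : RatField r :=
  hallLittlewoodSum lam (genZ r) (genT r)

/-- The Hall–Littlewood function `P_lam(z; t) = v_lam(t)⁻¹ R_lam(z; t)`, a priori a rational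
function. -/
noncomputable def hallLittlewoodP {r : ℕ} (lam : Fin r → ℕ) : RatField r :=
  (vLam lam (genT r))⁻¹ * hallLittlewoodR lam

/-- The value of a polynomial in `z_1, …, z_r` and `t` at a point. -/
noncomputable def evalAt {r : ℕ} {K : Type*} [CommRing K] (z : Fin r → K) (t : K)
    (p : MvPolynomial (Fin r) ℤ[X]) : K :=
  MvPolynomial.eval₂ (Polynomial.eval₂RingHom (Int.castRingHom K) t) z p

end BosonicModel

/-!
The `R`-weight partition function and the Hall–Littlewood function satisfy the same recursion in the
number of variables. On functions of a finite set of variables, let `C_c` be the operator that adds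
a part `c` by symmetrizing over one more variable, so that `R_λ` is obtained from the empty
partition by applying `C_c` once for each part `c`, smallest parts first. Specializing a variable
to `z` is an operator `T`, and with `M_c = [T, C_c]` one has

* `M_c C_c = t C_c M_c`, hence `T C_c ^ n = C_c ^ n T + [n] C_c ^ (n - 1) M_c`;
* `M_(c + 1) = z M_c + z (1 - t) C_c T`.

These are the four `R`-weights of the vertex in column `c`: the operators `T` and `M_c` correspond
to the horizontal spins `+` and `-`. Thus `T` acts on `R_λ` as the transfer operator of one row. The
first relation comes down to the rational function identity
`f(a, z) f(b, z) + t = f(a, b) f(b, z) + f(b, a) f(a, z)` for `f(a, b) = (a - t b) / (a - b)`.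

The `R`-weight of a vertex is its `P`-weight times `[top]! / [bottom]!`, and over a state these
factors telescope to the constant `v_λ(t)`.
-/

namespace BosonicModel

section RowSum

/-- The spin of the bottom edge of a vertex that conserves spin, given its other three spins. At
the inadmissible configuration `(+, 0, -)` the subtraction truncates and the value is `0`. -/
def bottomSpin (left : HSpin) (top : ℕ) (right : HSpin) : ℕ :=
  match left, right with
  | .plus, .plus => top
  | .minus, .minus => top
  | .minus, .plus => top + 1
  | .plus, .minus => top - 1

theorem sum_hSpin {V : Type*} [AddCommMonoid V] (f : HSpin → V) :
    ∑ s, f s = f .plus + f .minus :=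
  Finset.sum_pair (by decide)

variable {K V : Type*} [CommRing K] [AddCommGroup V] [Module K V] {M : ℕ}

/-- The spins of the edges below a row whose top spins are `m` and whose horizontal spins, counted
from the right, are `y`. -/
def rowBottom (m : Fin M → ℕ) (y : Fin (M + 1) → HSpin) (j : Fin M) : ℕ :=
  bottomSpin (y j.succ) (m j) (y j.castSucc)

/-- The Boltzmann weight of a row with top spins `m` and horizontal spins `y`. -/
def rowWeight (w : HSpin → ℕ → HSpin → ℕ → K) (m : Fin M → ℕ) (y : Fin (M + 1) → HSpin) : K :=
  ∏ j, w (y j.succ) (m j) (y j.castSucc) (rowBottom m y j)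

/-- The row transfer operator: the value of `F` at the bottom spins of a row, summed over all
horizontal spins with `s` on the left edge and `-` on the right edge. -/
def rowSum (w : HSpin → ℕ → HSpin → ℕ → K) (s : HSpin) (m : Fin M → ℕ)
    (F : (Fin M → ℕ) → V) : V :=
  ∑ y with y (Fin.last M) = s ∧ y 0 = .minus, rowWeight w m y • F (rowBottom m y)

theorem map_rowSum {W : Type*} [AddCommGroup W] [Module K W] (f : V →ₗ[K] W)
    (w : HSpin → ℕ → HSpin → ℕ → K) (s : HSpin) (m : Fin M → ℕ) (F : (Fin M → ℕ) → V) :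
    f (rowSum w s m F) = rowSum w s m fun k => f (F k) := by
  simp only [rowSum, map_sum, map_smul]

theorem rowSum_zero (w : HSpin → ℕ → HSpin → ℕ → K) (s : HSpin) (m : Fin 0 → ℕ)
    (F : (Fin 0 → ℕ) → V) : rowSum w s m F = if s = .minus then F m else 0 := by
  have hF (y : Fin 1 → HSpin) : rowWeight w m y • F (rowBottom m y) = F m := by
    rw [rowWeight, Fin.prod_univ_zero, one_smul, Subsingleton.elim (rowBottom m y) m]
  rw [rowSum, Finset.sum_filter, ← (Equiv.funUnique (Fin 1) HSpin).symm.sum_comp, sum_hSpin]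
  cases s <;> simp [hF]

theorem rowBottom_snoc (m : Fin (M + 1) → ℕ) (y : Fin (M + 1) → HSpin) (s : HSpin) :
    rowBottom m (Fin.snoc y s : Fin (M + 2) → HSpin) =
      Fin.snoc (rowBottom (Fin.init m) y) (bottomSpin s (m (Fin.last M)) (y (Fin.last M))) := by
  funext j
  cases j using Fin.lastCases with
  | last => simp [rowBottom]
  | cast j => simp only [rowBottom, Fin.snoc_castSucc, Fin.succ_castSucc, Fin.init]

theorem rowWeight_snoc (w : HSpin → ℕ → HSpin → ℕ → K) (m : Fin (M + 1) → ℕ)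
    (y : Fin (M + 1) → HSpin) (s : HSpin) :
    rowWeight w m (Fin.snoc y s : Fin (M + 2) → HSpin) =
      w s (m (Fin.last M)) (y (Fin.last M)) (bottomSpin s (m (Fin.last M)) (y (Fin.last M))) *
        rowWeight w (Fin.init m) y := by
  simp only [rowWeight, rowBottom_snoc, Fin.prod_univ_castSucc, Fin.succ_castSucc, Fin.succ_last,
    Fin.snoc_last, Fin.snoc_castSucc, Fin.init, mul_comm (w s _ _ _)]

theorem rowSum_succ (w : HSpin → ℕ → HSpin → ℕ → K) (s : HSpin) (m : Fin (M + 1) → ℕ)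
    (F : (Fin (M + 1) → ℕ) → V) :
    rowSum w s m F = ∑ s', w s (m (Fin.last M)) s' (bottomSpin s (m (Fin.last M)) s') •
      rowSum w s' (Fin.init m) fun k =>
        F (Fin.snoc k (bottomSpin s (m (Fin.last M)) s') : Fin (M + 1) → ℕ) := by
  have hsnoc (y : Fin (M + 1) → HSpin) (s' : HSpin) :
      (Fin.snocEquiv fun _ : Fin (M + 2) => HSpin) (s', y) = Fin.snoc y s' := rfl
  have hright (y : Fin (M + 1) → HSpin) (s' : HSpin) :
      (Fin.snoc y s' : Fin (M + 2) → HSpin) 0 = y 0 :=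
    Fin.snoc_castSucc (α := fun _ => HSpin) _ _ 0
  simp only [rowSum, Finset.sum_filter, Finset.smul_sum]
  rw [← (Fin.snocEquiv fun _ : Fin (M + 2) => HSpin).sum_comp, Fintype.sum_prod_type,
    Finset.sum_comm, Finset.sum_comm (s := Finset.univ (α := HSpin))]
  refine Finset.sum_congr rfl fun y _ => ?_
  simp only [hsnoc, Fin.snoc_last, hright, ite_and, smul_ite, smul_zero, Finset.sum_ite_eq,
    Finset.sum_ite_eq', Finset.mem_univ, if_true, rowBottom_snoc, rowWeight_snoc, mul_smul]

end RowSum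

section Grid

variable {K : Type*} [CommRing K] {M r N : ℕ} {lam : Fin r → ℕ}
  {w : K → HSpin → ℕ → HSpin → ℕ → K} {z : Fin r → K}

/-- The vertical spins that spin conservation forces on a grid with top spins `m` and horizontal
spins `h`, with the indexing of `State.v`. -/
def colSpins (m : Fin M → ℕ) (h : Fin r → Fin (M + 1) → HSpin) : Fin (r + 1) → Fin M → ℕ :=
  Fin.induction m fun i k => rowBottom k (h i)

theorem colSpins_zero (m : Fin M → ℕ) (h : Fin r → Fin (M + 1) → HSpin) : colSpins m h 0 = m :=
  rfl

theorem colSpins_succ (m : Fin M → ℕ) (h : Fin r → Fin (M + 1) → HSpin) (i : Fin r) :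
    colSpins m h i.succ = rowBottom (colSpins m h i.castSucc) (h i) :=
  rfl

theorem colSpins_cons_succ (m : Fin M → ℕ) (y : Fin (M + 1) → HSpin)
    (h : Fin r → Fin (M + 1) → HSpin) (i : Fin (r + 1)) :
    colSpins m (Fin.cons y h : Fin (r + 1) → Fin (M + 1) → HSpin) i.succ =
      colSpins (rowBottom m y) h i := by
  induction i using Fin.induction with
  | zero => rfl
  | succ i ih => rw [colSpins_succ, Fin.cons_succ, ← Fin.succ_castSucc, ih, colSpins_succ]

/-- The partition function of a spin-conserving model on a grid with arbitrary top spins `m`, as a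
finite sum over horizontal spins (see `partitionFunction_eq_gridSum`). -/
def gridSum (w : K → HSpin → ℕ → HSpin → ℕ → K) (z : Fin r → K) (m : Fin M → ℕ) : K :=
  ∑ h : Fin r → Fin (M + 1) → HSpin with
    (∀ i, h i (Fin.last M) = .plus ∧ h i 0 = .minus) ∧ colSpins m h (Fin.last r) = 0,
    ∏ i, rowWeight (w (z i)) (colSpins m h i.castSucc) (h i)

theorem gridSum_zero (w : K → HSpin → ℕ → HSpin → ℕ → K) (z : Fin 0 → K) (m : Fin M → ℕ) :
    gridSum w z m = if m = 0 then 1 else 0 := by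
  rw [gridSum, Finset.sum_filter, Fintype.sum_unique]
  simp [colSpins]

theorem gridSum_succ (w : K → HSpin → ℕ → HSpin → ℕ → K) (z : Fin (r + 1) → K) (m : Fin M → ℕ) :
    gridSum w z m = rowSum (w (z 0)) .plus m (gridSum w (Fin.tail z)) := by
  have hcons (y : Fin (M + 1) → HSpin) (h : Fin r → Fin (M + 1) → HSpin) :
      (Fin.consEquiv fun _ : Fin (r + 1) => Fin (M + 1) → HSpin) (y, h) = Fin.cons y h := rfl
  simp only [gridSum, rowSum, Finset.sum_filter]
  rw [← (Fin.consEquiv fun _ : Fin (r + 1) => Fin (M + 1) → HSpin).sum_comp,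
    Fintype.sum_prod_type]
  refine Finset.sum_congr rfl fun y _ => ?_
  simp only [hcons, Fin.forall_fin_succ, Fin.prod_univ_succ, Fin.cons_zero, Fin.cons_succ,
    ← Fin.succ_last, ← Fin.succ_castSucc, colSpins_cons_succ, Fin.castSucc_zero, colSpins_zero]
  by_cases hy : y (Fin.last M) = .plus ∧ y 0 = .minus
  · simp only [hy, true_and, if_true, and_self, smul_eq_mul, Finset.mul_sum, mul_ite, mul_zero]
    rfl
  · simp only [hy, false_and, if_false, Finset.sum_const_zero]

/-- The state with horizontal spins `h` and the vertical spins forced by spin conservation. -/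
def State.ofHorizontal (lam : Fin r → ℕ) (h : Fin r → Fin (N + 2) → HSpin)
    (hh : ∀ i, h i (Fin.last (N + 1)) = .plus ∧ h i 0 = .minus)
    (hbot : colSpins (fun j : Fin (N + 1) => mult lam j) h (Fin.last r) = 0) : State r N lam where
  h := h
  v := colSpins (fun j => mult lam j) h
  left_boundary i := (hh i).1
  right_boundary i := (hh i).2
  top_boundary _ := rfl
  bottom_boundary j := congrFun hbot j

theorem State.v_eq_colSpins (hw : ∀ x a b c d, w x a b c d ≠ 0 → d = bottomSpin a b c)
    {s : State r N lam} (hs : s.weight w z ≠ 0) :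
    s.v = colSpins (fun j => mult lam j) s.h := by
  funext i
  induction i using Fin.induction with
  | zero => exact funext s.top_boundary
  | succ i ih =>
    rw [colSpins_succ, ← ih]
    funext j
    refine hw (z i) _ _ _ _ fun hzero => hs ?_
    exact Finset.prod_eq_zero (Finset.mem_univ i) (Finset.prod_eq_zero (Finset.mem_univ j) hzero)

theorem State.weight_eq_prod_rowWeight {s : State r N lam}
    (hs : s.v = colSpins (fun j => mult lam j) s.h) :
    s.weight w z =
      ∏ i, rowWeight (w (z i)) (colSpins (fun j => mult lam j) s.h i.castSucc) (s.h i) := by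
  rw [State.weight, hs]
  rfl

theorem partitionFunction_eq_gridSum
    (hw : ∀ x a b c d, w x a b c d ≠ 0 → d = bottomSpin a b c) :
    partitionFunction N lam w z = gridSum w z fun j : Fin (N + 1) => mult lam j := by
  have hfin : (Function.support fun s : State r N lam => s.weight w z).Finite :=
    finite_support_weight w z fun x a b c d h => by
      rw [hw x a b c d h]
      cases a <;> cases c <;> simp only [bottomSpin] <;> omega
  rw [partitionFunction, finsum_eq_sum _ hfin]
  refine Finset.sum_bij_ne_zero (fun s _ _ => s.h) ?_ ?_ ?_ ?_
  · intro s _ hs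
    rw [Finset.mem_filter_univ, ← State.v_eq_colSpins hw hs]
    exact ⟨fun i => ⟨s.left_boundary i, s.right_boundary i⟩, funext s.bottom_boundary⟩
  · intro s _ hs s' _ hs' hh
    exact State.ext hh (by rw [State.v_eq_colSpins hw hs, State.v_eq_colSpins hw hs', hh])
  · intro h hmem hne
    obtain ⟨hh, hbot⟩ := (Finset.mem_filter_univ h).mp hmem
    have hs : (State.ofHorizontal lam h hh hbot).weight w z ≠ 0 := by
      rwa [State.weight_eq_prod_rowWeight rfl]
    exact ⟨_, hfin.mem_toFinset.mpr hs, hs, rfl⟩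
  · intro s _ hs
    exact State.weight_eq_prod_rowWeight (State.v_eq_colSpins hw hs)

theorem eq_bottomSpin_of_weightR_ne_zero {t x : K} {a c : HSpin} {b d : ℕ}
    (h : weightR t x a b c d ≠ 0) : d = bottomSpin a b c := by
  cases a <;> cases c <;>
    simp only [weightR, ne_eq, ite_eq_right_iff, Classical.not_imp, bottomSpin] at h ⊢ <;> omega

end Grid

theorem qInt_succ {K : Type*} [CommRing K] (t : K) (n : ℕ) :
    qInt t (n + 1) = qInt t n + t ^ n :=
  Finset.sum_range_succ _ n

theorem one_sub_mul_qInt {R : Type*} [CommRing R] (t : R) (n : ℕ) :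
    (1 - t) * qInt t n = 1 - t ^ n :=
  mul_neg_geom_sum t n

section Creation

variable {K : Type*} [Field K] {t z : K}

/-- The factor `(a - t b) / (a - b)` of the Hall–Littlewood symmetrization. -/
def hlFactor (t a b : K) : K :=
  (a - t * b) / (a - b)

theorem hlFactor_add_hlFactor {a b : K} (hab : a ≠ b) :
    hlFactor t a b + hlFactor t b a = 1 + t := by
  have h : a - b ≠ 0 := sub_ne_zero.mpr hab
  rw [hlFactor, hlFactor, ← neg_sub a b, div_neg, ← sub_eq_add_neg, ← sub_div, div_eq_iff h]
  ring

theorem sub_mul_hlFactor_sub_one {a b : K} (hab : a ≠ b) :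
    (a - b) * (hlFactor t a b - 1) = b * (1 - t) := by
  have h : a - b ≠ 0 := sub_ne_zero.mpr hab
  rw [hlFactor, mul_sub, mul_div_cancel₀ _ h]
  ring

theorem hlFactor_mul_hlFactor_add {a b : K} (hab : a ≠ b) (haz : a ≠ z) (hbz : b ≠ z) :
    hlFactor t a z * hlFactor t b z + t =
      hlFactor t a b * hlFactor t b z + hlFactor t b a * hlFactor t a z := by
  have h₁ : a - b ≠ 0 := sub_ne_zero.mpr hab
  have h₂ : a - z ≠ 0 := sub_ne_zero.mpr haz
  have h₃ : b - z ≠ 0 := sub_ne_zero.mpr hbz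
  have hba : hlFactor t b a = 1 + t - hlFactor t a b := by
    rw [← hlFactor_add_hlFactor hab]
    ring
  rw [hba]
  simp only [hlFactor]
  field_simp
  ring

variable [DecidableEq K] {g : K → K} {X : Finset K}

/-- The operator on functions of a finite set of variables that adds one variable `a`, coupled to
the other variables by the factors `(a - t b) / (a - b)` and weighted by `g a`, and symmetrizes.
Applied to the constant `1` on the empty set, the product of the operators for `g a = a ^ λ_i` is
the Hall–Littlewood function `R_λ` (see `hallLittlewoodSum_eq_hlFunction`). -/
def creation (t : K) (g : K → K) : Module.End K (Finset K → K) where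
  toFun F X := ∑ a ∈ X, g a * (∏ b ∈ X.erase a, hlFactor t a b) * F (X.erase a)
  map_add' F G := by
    ext X
    simp only [Pi.add_apply, mul_add, Finset.sum_add_distrib]
  map_smul' k F := by
    ext X
    simp only [Pi.smul_apply, smul_eq_mul, Finset.mul_sum, RingHom.id_apply, mul_left_comm k]

theorem creation_apply (F : Finset K → K) (X : Finset K) :
    creation t g F X = ∑ a ∈ X, g a * (∏ b ∈ X.erase a, hlFactor t a b) * F (X.erase a) :=
  rfl

/-- The operator that specializes one of the variables to `z`. It is only meaningful on sets that
do not contain `z`, hence the relations below are equalities on `{X | z ∉ X}`. -/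
def adjoin (z : K) : Module.End K (Finset K → K) :=
  LinearMap.funLeft K K (insert z)

theorem adjoin_apply (F : Finset K → K) (X : Finset K) : adjoin z F X = F (insert z X) :=
  rfl

theorem adjoin_creation_apply (F : Finset K → K) (hz : z ∉ X) :
    adjoin z (creation t g F) X = g z * (∏ b ∈ X, hlFactor t z b) * F X +
      creation t (fun a => g a * hlFactor t a z) (adjoin z F) X := by
  rw [adjoin_apply, creation_apply, Finset.sum_insert hz, Finset.erase_insert hz, creation_apply]
  congr 1
  refine Finset.sum_congr rfl fun a ha => ?_
  rw [Finset.erase_insert_of_ne (ne_of_mem_of_not_mem ha hz).symm,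
    Finset.prod_insert (fun h => hz (Finset.mem_of_mem_erase h)), adjoin_apply, ← mul_assoc]

theorem creation_eqOn {F G : Finset K → K} (h : Set.EqOn F G {X | z ∉ X}) :
    Set.EqOn (creation t g F) (creation t g G) {X | z ∉ X} := fun X hX =>
  Finset.sum_congr rfl fun _ _ => by rw [h fun hz => hX (Finset.mem_of_mem_erase hz)]

theorem creation_pow_eqOn {F G : Finset K → K} (h : Set.EqOn F G {X | z ∉ X}) (n : ℕ) :
    Set.EqOn ((creation t g ^ n) F) ((creation t g ^ n) G) {X | z ∉ X} := by
  induction n with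
  | zero => exact h
  | succ n ih => simpa only [pow_succ', Module.End.mul_apply] using creation_eqOn ih

theorem sum_sum_erase_eq_zero_of_add_swap_eq_zero {α M : Type*} [DecidableEq α] [AddCommMonoid M]
    {s : Finset α} {f : α → α → M}
    (hf : ∀ a ∈ s, ∀ b ∈ s, a ≠ b → f a b + f b a = 0) : ∑ a ∈ s, ∑ b ∈ s.erase a, f a b = 0 := by
  have hoff : ∑ p ∈ s.offDiag, f p.1 p.2 = ∑ a ∈ s, ∑ b ∈ s.erase a, f a b :=
    Finset.sum_finset_product _ _ _ fun p => by
      simp only [Finset.mem_offDiag, Finset.mem_erase, ne_eq, eq_comm (a := p.1)]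
      tauto
  rw [← hoff]
  refine Finset.sum_involution (fun p _ => p.swap) ?_ ?_ ?_ fun p _ => p.swap_swap
  · intro p hp
    obtain ⟨ha, hb, hab⟩ := Finset.mem_offDiag.mp hp
    exact hf _ ha _ hb hab
  · intro p hp _ hswap
    exact (Finset.mem_offDiag.mp hp).2.2 (congrArg Prod.snd hswap)
  · intro p hp
    obtain ⟨ha, hb, hab⟩ := Finset.mem_offDiag.mp hp
    exact Finset.mem_offDiag.mpr ⟨hb, ha, hab.symm⟩

theorem lie_adjoin_creation_apply (F : Finset K → K) (hz : z ∉ X) :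
    ⁅adjoin z, creation t g⁆ F X = g z * (∏ b ∈ X, hlFactor t z b) * F X +
      creation t (fun a => g a * (hlFactor t a z - 1)) (adjoin z F) X := by
  rw [LieRing.of_associative_ring_bracket, LinearMap.sub_apply, Module.End.mul_apply,
    Module.End.mul_apply, Pi.sub_apply, adjoin_creation_apply F hz, add_sub_assoc]
  simp only [creation_apply, ← Finset.sum_sub_distrib]
  congr 1
  exact Finset.sum_congr rfl fun a _ => by ring

theorem creation_creation_apply (g h : K → K) (F : Finset K → K) (X : Finset K) :
    creation t g (creation t h F) X = ∑ a ∈ X, ∑ b ∈ X.erase a, g a * h b * hlFactor t a b *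
      ((∏ c ∈ (X.erase a).erase b, hlFactor t a c * hlFactor t b c) *
        F ((X.erase a).erase b)) := by
  simp only [creation_apply, Finset.mul_sum]
  refine Finset.sum_congr rfl fun a _ => Finset.sum_congr rfl fun b hb => ?_
  rw [← Finset.mul_prod_erase _ _ hb, Finset.prod_mul_distrib]
  ring

theorem creation_hlFactor_sub_one_creation (F : Finset K → K) (hz : z ∉ X) :
    creation t (fun a => g a * (hlFactor t a z - 1))
        (creation t (fun a => g a * hlFactor t a z) F) X =
      t * creation t g (creation t (fun a => g a * (hlFactor t a z - 1)) F) X := by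
  have hXz : ∀ a ∈ X, a ≠ z := fun a ha => ne_of_mem_of_not_mem ha hz
  let common (a b : K) : K := g a * g b *
    ((∏ c ∈ (X.erase a).erase b, hlFactor t a c * hlFactor t b c) * F ((X.erase a).erase b))
  have common_comm (a b : K) : common b a = common a b := by
    simp only [common, Finset.erase_right_comm (a := b) (b := a), mul_comm (hlFactor t b _),
      mul_comm (g b)]
  rw [← sub_eq_zero, creation_creation_apply, creation_creation_apply]
  simp only [Finset.mul_sum, ← Finset.sum_sub_distrib]
  refine sum_sum_erase_eq_zero_of_add_swap_eq_zero fun a ha b hb hab => ?_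
  trans common a b * (hlFactor t a b * ((hlFactor t a z - 1) * hlFactor t b z -
      t * (hlFactor t b z - 1))) +
    common b a * (hlFactor t b a * ((hlFactor t b z - 1) * hlFactor t a z -
      t * (hlFactor t a z - 1)))
  · simp only [common]
    ring
  rw [common_comm a b]
  generalize common a b = c
  linear_combination c * (
    (hlFactor t a z * hlFactor t b z + t) * hlFactor_add_hlFactor (t := t) hab +
    (1 + t) * hlFactor_mul_hlFactor_add (t := t) hab (hXz a ha) (hXz b hb))

theorem lie_adjoin_creation_creation (F : Finset K → K) :
    Set.EqOn (⁅adjoin z, creation t g⁆ (creation t g F))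
      (t • creation t g (⁅adjoin z, creation t g⁆ F)) {X | z ∉ X} := by
  intro X hX
  let H : Finset K → K := fun Y => g z * (∏ b ∈ Y, hlFactor t z b) * F Y
  have hTC : Set.EqOn (adjoin z (creation t g F))
      (H + creation t (fun a => g a * hlFactor t a z) (adjoin z F)) {X | z ∉ X} :=
    fun Y hY => adjoin_creation_apply F hY
  have hM : Set.EqOn (⁅adjoin z, creation t g⁆ F)
      (H + creation t (fun a => g a * (hlFactor t a z - 1)) (adjoin z F)) {X | z ∉ X} :=
    fun Y hY => lie_adjoin_creation_apply F hY
  have hH : g z * (∏ b ∈ X, hlFactor t z b) * creation t g F X +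
      creation t (fun a => g a * (hlFactor t a z - 1)) H X = t * creation t g H X := by
    simp only [creation_apply, H, Finset.mul_sum, ← Finset.sum_add_distrib]
    refine Finset.sum_congr rfl fun a ha => ?_
    rw [← Finset.mul_prod_erase X _ ha]
    linear_combination g z * g a * (∏ b ∈ X.erase a, hlFactor t a b) *
      (∏ b ∈ X.erase a, hlFactor t z b) * F (X.erase a) *
      hlFactor_add_hlFactor (t := t) (ne_of_mem_of_not_mem ha hX)
  rw [lie_adjoin_creation_apply _ hX, creation_eqOn hTC hX, Pi.smul_apply, smul_eq_mul,
    creation_eqOn hM hX, map_add, map_add, Pi.add_apply, Pi.add_apply, mul_add, ← add_assoc, hH,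
    creation_hlFactor_sub_one_creation _ hX]

theorem lie_adjoin_creation_creation_pow (F : Finset K → K) (n : ℕ) :
    Set.EqOn (⁅adjoin z, creation t g⁆ ((creation t g ^ n) F))
      (t ^ n • (creation t g ^ n) (⁅adjoin z, creation t g⁆ F)) {X | z ∉ X} := by
  induction n with
  | zero => simpa using Set.eqOn_refl _ _
  | succ n ih =>
    intro X hX
    rw [pow_succ', Module.End.mul_apply, lie_adjoin_creation_creation _ hX, Pi.smul_apply,
      creation_eqOn ih hX, map_smul, pow_succ' t, mul_smul, Module.End.mul_apply]
    rfl

theorem creation_creation_pow (F : Finset K → K) (n : ℕ) :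
    creation t g ((creation t g ^ n) F) = (creation t g ^ (n + 1)) F := by
  rw [pow_succ', Module.End.mul_apply]

theorem qInt_smul_creation_creation_pow_pred (F : Finset K → K) (n : ℕ) :
    qInt t n • creation t g ((creation t g ^ (n - 1)) F) = qInt t n • (creation t g ^ n) F := by
  cases n with
  | zero => simp [qInt]
  | succ n => rw [Nat.add_sub_cancel, creation_creation_pow]

theorem adjoin_creation (F : Finset K → K) :
    adjoin z (creation t g F) = creation t g (adjoin z F) + ⁅adjoin z, creation t g⁆ F := by
  rw [LieRing.of_associative_ring_bracket, LinearMap.sub_apply, Module.End.mul_apply,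
    Module.End.mul_apply, add_sub_cancel]

theorem adjoin_creation_pow (F : Finset K → K) (n : ℕ) :
    Set.EqOn (adjoin z ((creation t g ^ n) F))
      ((creation t g ^ n) (adjoin z F) +
        qInt t n • (creation t g ^ (n - 1)) (⁅adjoin z, creation t g⁆ F)) {X | z ∉ X} := by
  induction n with
  | zero => simpa [qInt] using Set.eqOn_refl _ _
  | succ n ih =>
    intro X hX
    rw [← creation_creation_pow, adjoin_creation, Pi.add_apply, creation_eqOn ih hX,
      lie_adjoin_creation_creation_pow F n hX, map_add, map_smul,
      qInt_smul_creation_creation_pow_pred, creation_creation_pow, qInt_succ, add_smul,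
      ← add_assoc, Nat.add_sub_cancel]
    rfl

theorem lie_adjoin_creation_pow_succ (F : Finset K → K) (c : ℕ) :
    Set.EqOn (⁅adjoin z, creation t (· ^ (c + 1))⁆ F)
      (z • ⁅adjoin z, creation t (· ^ c)⁆ F +
        (z * (1 - t)) • creation t (· ^ c) (adjoin z F)) {X | z ∉ X} := by
  intro X hX
  simp only [Pi.add_apply, Pi.smul_apply, smul_eq_mul, lie_adjoin_creation_apply _ hX,
    creation_apply, mul_add, Finset.mul_sum, add_assoc, ← Finset.sum_add_distrib]
  congr 1
  · ring
  refine Finset.sum_congr rfl fun a ha => ?_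
  linear_combination a ^ c * (∏ b ∈ X.erase a, hlFactor t a b) * adjoin z F (X.erase a) *
    sub_mul_hlFactor_sub_one (t := t) (ne_of_mem_of_not_mem ha hX)

end Creation

section HallLittlewoodFunction

variable {K : Type*} [Field K] [DecidableEq K] {t z : K}

/-- The function of a finite set of variables that is `1` on the empty set and `0` elsewhere, from
which the creation operators build the Hall–Littlewood functions. -/
def vacuum : Finset K → K :=
  Pi.single ∅ 1

theorem adjoin_vacuum : adjoin z (vacuum : Finset K → K) = 0 := by
  ext X
  simp [adjoin_apply, vacuum]

theorem lie_adjoin_creation_pow_zero_vacuum :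
    Set.EqOn (⁅adjoin z, creation t (· ^ 0)⁆ vacuum) vacuum {X | z ∉ X} := by
  intro X hX
  rw [lie_adjoin_creation_apply _ hX, adjoin_vacuum, map_zero, Pi.zero_apply, add_zero, pow_zero,
    one_mul]
  rcases eq_or_ne X ∅ with rfl | hne
  · rw [Finset.prod_empty, one_mul]
  · rw [vacuum, Pi.single_eq_of_ne hne, mul_zero]

/-- The Hall–Littlewood function `R_λ` for the partition `λ` that has `m j` parts equal to `j` for
`j < M`, as a function of its set of variables; it vanishes unless the number of variables is the
number of parts of `λ`. -/
def hlFunction (t : K) : (M : ℕ) → (Fin M → ℕ) → Finset K → K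
  | 0, _ => vacuum
  | M + 1, m => (creation t (· ^ M) ^ m (Fin.last M)) (hlFunction t M (Fin.init m))

theorem hlFunction_succ {M : ℕ} (m : Fin (M + 1) → ℕ) :
    hlFunction t (M + 1) m =
      (creation t (· ^ M) ^ m (Fin.last M)) (hlFunction t M (Fin.init m)) :=
  rfl

theorem hlFunction_snoc {M : ℕ} (m : Fin M → ℕ) (n : ℕ) :
    hlFunction t (M + 1) (Fin.snoc m n) = (creation t (· ^ M) ^ n) (hlFunction t M m) := by
  rw [hlFunction_succ, Fin.snoc_last, Fin.init_snoc]

theorem weightR_plus_minus_bottomSpin {R : Type*} [CommRing R] (t z : R) (n : ℕ) :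
    weightR t z .plus n .minus (bottomSpin .plus n .minus) = qInt t n := by
  cases n <;> simp [weightR, bottomSpin, qInt]

theorem lie_adjoin_creation_succ_creation_pow (F : Finset K → K) (c n : ℕ) :
    Set.EqOn (⁅adjoin z, creation t (· ^ (c + 1))⁆ ((creation t (· ^ c) ^ n) F))
      (z • (creation t (· ^ c) ^ n) (⁅adjoin z, creation t (· ^ c)⁆ F) +
        (z * (1 - t)) • (creation t (· ^ c) ^ (n + 1)) (adjoin z F)) {X | z ∉ X} := by
  intro X hX
  rw [lie_adjoin_creation_pow_succ _ _ hX, Pi.add_apply, Pi.smul_apply, Pi.smul_apply,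
    lie_adjoin_creation_creation_pow _ _ hX, creation_eqOn (adjoin_creation_pow _ _) hX, map_add,
    map_smul, qInt_smul_creation_creation_pow_pred, creation_creation_pow]
  simp only [Pi.add_apply, Pi.smul_apply, smul_eq_mul]
  linear_combination z * (creation t (· ^ c) ^ n) (⁅adjoin z, creation t (· ^ c)⁆ F) X *
    one_sub_mul_qInt t n

theorem adjoin_hlFunction_and_lie_adjoin_creation_hlFunction {M : ℕ} (m : Fin M → ℕ) :
    Set.EqOn (adjoin z (hlFunction t M m))
        (rowSum (weightR t z) .plus m (hlFunction t M)) {X | z ∉ X} ∧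
      Set.EqOn (⁅adjoin z, creation t (· ^ M)⁆ (hlFunction t M m))
        (rowSum (weightR t z) .minus m (hlFunction t M)) {X | z ∉ X} := by
  induction M with
  | zero =>
    rw [rowSum_zero, rowSum_zero]
    exact ⟨fun X _ => congrFun adjoin_vacuum X, lie_adjoin_creation_pow_zero_vacuum⟩
  | succ M ih =>
    obtain ⟨ihplus, ihminus⟩ := ih (Fin.init m)
    have hplus (n : ℕ) := creation_pow_eqOn (t := t) (g := (· ^ M)) ihplus n
    have hminus (n : ℕ) := creation_pow_eqOn (t := t) (g := (· ^ M)) ihminus n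
    simp only [rowSum_succ, sum_hSpin, hlFunction_snoc, ← map_rowSum]
    refine ⟨fun X hX => ?_, fun X hX => ?_⟩
    · rw [hlFunction_succ, adjoin_creation_pow _ _ hX, weightR_plus_minus_bottomSpin]
      simp [hplus _ hX, hminus _ hX, weightR, bottomSpin]
    · rw [hlFunction_succ, lie_adjoin_creation_succ_creation_pow _ _ _ hX, add_comm]
      simp [hplus _ hX, hminus _ hX, weightR, bottomSpin]

theorem hlFunction_empty {M : ℕ} (m : Fin M → ℕ) :
    hlFunction t M m ∅ = if m = 0 then 1 else 0 := by
  induction M with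
  | zero => simp [hlFunction, vacuum, eq_iff_true_of_subsingleton]
  | succ M ih =>
    have hm : m = 0 ↔ Fin.init m = 0 ∧ m (Fin.last M) = 0 := by
      simp only [funext_iff, Fin.forall_fin_succ', Fin.init, Pi.zero_apply]
    simp only [hlFunction_succ, hm]
    cases m (Fin.last M) with
    | zero => simp [ih]
    | succ n => simp [pow_succ', creation_apply]

theorem gridSum_weightR_eq_hlFunction {r M : ℕ} {z : Fin r → K} (hz : Function.Injective z)
    (m : Fin M → ℕ) : gridSum (weightR t) z m = hlFunction t M m (Finset.univ.image z) := by
  induction r generalizing m with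
  | zero => rw [gridSum_zero, Finset.univ_eq_empty, Finset.image_empty, hlFunction_empty]
  | succ r ih =>
    have htail : Function.Injective (Fin.tail z) := hz.comp (Fin.succ_injective r)
    have hX : z 0 ∉ Finset.univ.image (Fin.tail z) := by
      simp [Fin.tail, hz.eq_iff]
    have himage : Finset.univ.image z = insert (z 0) (Finset.univ.image (Fin.tail z)) := by
      rw [Fin.univ_succ, Finset.cons_eq_insert, Finset.image_insert, Finset.map_eq_image,
        Finset.image_image]
      rfl
    rw [himage, ← adjoin_apply (hlFunction t M m),
      (adjoin_hlFunction_and_lie_adjoin_creation_hlFunction m).1 hX, gridSum_succ]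
    simp only [rowSum, Finset.sum_apply, Pi.smul_apply, ih htail]

end HallLittlewoodFunction

section Symmetrization

theorem image_swap_succ {α : Type*} [DecidableEq α] {r : ℕ} {z : Fin (r + 1) → α}
    (hz : Function.Injective z) (p : Fin (r + 1)) :
    Finset.univ.image (fun j : Fin r => z (Equiv.swap 0 p j.succ)) =
      (Finset.univ.image z).erase (z p) := by
  have hswap : Function.Injective (z ∘ Equiv.swap 0 p) := hz.comp (Equiv.injective _)
  have hsucc : Finset.univ.image (Fin.succ : Fin r → Fin (r + 1)) = Finset.univ.erase 0 := by
    rw [Fin.image_succ_univ, ← Finset.compl_singleton]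
  calc Finset.univ.image (fun j : Fin r => z (Equiv.swap 0 p j.succ))
      = (Finset.univ.erase 0).image (z ∘ Equiv.swap 0 p) := by
        rw [← hsucc, Finset.image_image]
        rfl
    _ = (Finset.univ.image z).erase (z p) := by
        rw [Finset.image_erase hswap, ← Finset.image_image, Finset.image_univ_equiv,
          Function.comp_apply, Equiv.swap_apply_left]

variable {K : Type*} [Field K] {t : K} {r : ℕ}

theorem hallLittlewoodSum_succ (lam : Fin (r + 1) → ℕ) (z : Fin (r + 1) → K) :
    hallLittlewoodSum lam z t = ∑ p, z p ^ lam 0 *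
      (∏ j : Fin r, hlFactor t (z p) (z (Equiv.swap 0 p j.succ))) *
        hallLittlewoodSum (Fin.tail lam) (fun j => z (Equiv.swap 0 p j.succ)) t := by
  rw [hallLittlewoodSum, ← Equiv.Perm.decomposeFin.symm.sum_comp, Fintype.sum_prod_type]
  refine Finset.sum_congr rfl fun p _ => ?_
  rw [hallLittlewoodSum, Finset.mul_sum]
  refine Finset.sum_congr rfl fun e _ => ?_
  rw [← Equiv.prod_comp e fun j => hlFactor t (z p) (z (Equiv.swap 0 p j.succ))]
  simp only [Fin.prod_univ_succ, Fin.prod_Ioi_zero, Fin.prod_Ioi_succ, hlFactor, Fin.tail,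
    Equiv.Perm.decomposeFin_symm_apply_zero, Equiv.Perm.decomposeFin_symm_apply_succ]
  ring

theorem mult_succ (lam : Fin (r + 1) → ℕ) (j : ℕ) :
    mult lam j = mult (Fin.tail lam) j + if lam 0 = j then 1 else 0 := by
  rw [mult, Fin.card_filter_univ_succ, mult]
  split_ifs <;> rfl

theorem mult_eq_zero_iff {lam : Fin r → ℕ} {j : ℕ} : mult lam j = 0 ↔ ∀ i, lam i ≠ j := by
  simp [mult, Finset.filter_eq_empty_iff]

theorem creation_hlFunction [DecidableEq K] {M : ℕ} {m : Fin M → ℕ} {c : Fin M}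
    (hm : ∀ j, c < j → m j = 0) :
    creation t (· ^ (c : ℕ)) (hlFunction t M m) = hlFunction t M (m + Pi.single c 1) := by
  induction M with
  | zero => exact c.elim0
  | succ M ih =>
    cases c using Fin.lastCases with
    | last =>
      have hinit : Fin.init (m + Pi.single (Fin.last M) 1) = Fin.init m := by
        funext j
        simp [Fin.init, (Fin.castSucc_lt_last j).ne]
      rw [hlFunction_succ, hlFunction_succ, hinit, Fin.val_last, creation_creation_pow,
        Pi.add_apply, Pi.single_eq_same]
    | cast c =>
      have hlast : m (Fin.last M) = 0 := hm _ (Fin.castSucc_lt_last c)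
      have hinit : Fin.init (m + Pi.single c.castSucc 1) = Fin.init m + Pi.single c 1 := by
        funext j
        simp [Fin.init, Pi.single_apply]
      rw [hlFunction_succ, hlFunction_succ, hinit, ← ih (m := Fin.init m) fun j hj => hm _ hj,
        Pi.add_apply, hlast, Pi.single_eq_of_ne (Fin.castSucc_lt_last c).ne', add_zero, pow_zero]
      rfl

theorem hallLittlewoodSum_eq_hlFunction [DecidableEq K] {M : ℕ} {lam : Fin r → ℕ}
    (hlam : Antitone lam) (hM : ∀ i, lam i < M) {z : Fin r → K} (hz : Function.Injective z) :
    hallLittlewoodSum lam z t =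
      hlFunction t M (fun j => mult lam j) (Finset.univ.image z) := by
  induction r with
  | zero => simp [hallLittlewoodSum, hlFunction_empty, mult, funext_iff]
  | succ r ih =>
    have hmult : (fun j : Fin M => mult lam j) =
        (fun j : Fin M => mult (Fin.tail lam) j) + Pi.single ⟨lam 0, hM 0⟩ 1 := by
      funext j
      simp [mult_succ, Pi.single_apply, Fin.ext_iff, eq_comm]
    have htail : ∀ j : Fin M, ⟨lam 0, hM 0⟩ < j → mult (Fin.tail lam) j = 0 := fun j hj =>
      mult_eq_zero_iff.mpr fun i => ((hlam (Fin.zero_le i.succ)).trans_lt hj).ne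
    rw [hmult, ← creation_hlFunction htail, creation_apply, Finset.sum_image hz.injOn,
      hallLittlewoodSum_succ]
    refine Finset.sum_congr rfl fun p _ => ?_
    have hzp : Function.Injective fun j : Fin r => z (Equiv.swap 0 p j.succ) :=
      hz.comp ((Equiv.injective _).comp (Fin.succ_injective r))
    rw [← image_swap_succ hz, Finset.prod_image hzp.injOn,
      ih (lam := Fin.tail lam) (fun i j hij => hlam (Fin.succ_le_succ_iff.mpr hij))
        (fun i => hM i.succ) hzp]

theorem ZR_eq_hallLittlewoodSum {N : ℕ} {lam : Fin r → ℕ} (hlam : Antitone lam)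
    (hN : ∀ i, lam i ≤ N) {z : Fin r → K} (hz : Function.Injective z) :
    ZR N lam z t = hallLittlewoodSum lam z t := by
  classical
  rw [ZR, partitionFunction_eq_gridSum fun _ _ _ _ _ => eq_bottomSpin_of_weightR_ne_zero,
    gridSum_weightR_eq_hlFunction hz,
    hallLittlewoodSum_eq_hlFunction hlam (fun i => Nat.lt_succ_of_le (hN i)) hz]

end Symmetrization

section GaugeTransformation

/-- The `t`-factorial `[n]! = [1] [2] ⋯ [n]`. Multiplying the weight of
every vertex by `[bottom]! / [top]!` turns the `R`-weights into the `P`-weights. -/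
def qFactorial {K : Type*} [CommRing K] (t : K) (n : ℕ) : K :=
  ∏ i ∈ Finset.range n, qInt t (i + 1)

theorem weightR_mul_qFactorial {K : Type*} [CommRing K] (t z : K) (a : HSpin) (b : ℕ) (c : HSpin)
    (d : ℕ) : weightR t z a b c d * qFactorial t d = weightP t z a b c d * qFactorial t b := by
  have hsucc (n : ℕ) : qFactorial t (n + 1) = qFactorial t n * qInt t (n + 1) :=
    Finset.prod_range_succ _ n
  cases a <;> cases c <;> simp only [weightR, weightP] <;> split_ifs with h <;>
    simp only [h, hsucc, zero_mul, one_mul]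
  · exact mul_comm _ _
  · rw [← one_sub_mul_qInt]
    ring

theorem State.weight_weightR {K : Type*} [CommRing K] [IsDomain K] {r N : ℕ} {lam : Fin r → ℕ}
    {t : K} (ht : ∀ n, qFactorial t n ≠ 0) (z : Fin r → K) (s : State r N lam) :
    s.weight (weightR t) z =
      (∏ j : Fin (N + 1), qFactorial t (mult lam j)) * s.weight (weightP t) z := by
  have hgauge : s.weight (weightR t) z * ∏ i : Fin r, ∏ j, qFactorial t (s.v i.succ j) =
      s.weight (weightP t) z * ∏ i : Fin r, ∏ j, qFactorial t (s.v i.castSucc j) := by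
    simp only [State.weight, ← Finset.prod_mul_distrib, weightR_mul_qFactorial]
  have htelescope : ∏ i : Fin r, ∏ j, qFactorial t (s.v i.castSucc j) =
      (∏ j : Fin (N + 1), qFactorial t (mult lam j)) *
        ∏ i : Fin r, ∏ j, qFactorial t (s.v i.succ j) := by
    have h := Fin.prod_univ_castSucc fun i => ∏ j, qFactorial t (s.v i j)
    rw [Fin.prod_univ_succ] at h
    simpa [s.top_boundary, s.bottom_boundary, qFactorial] using h.symm
  have hne : ∏ i : Fin r, ∏ j, qFactorial t (s.v i.succ j) ≠ 0 :=
    Finset.prod_ne_zero_iff.mpr fun _ _ => Finset.prod_ne_zero_iff.mpr fun _ _ => ht _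
  refine mul_right_cancel₀ hne ?_
  rw [hgauge, htelescope]
  ring

variable {K : Type*} [Field K] {r N : ℕ} {lam : Fin r → ℕ} {t : K}

theorem vNum_eq_qFactorial (ht : t ≠ 1) (n : ℕ) : vNum t n = qFactorial t n := by
  simp only [vNum, qFactorial, qInt_eq_div ht]
  rw [Finset.range_eq_Ico, Finset.prod_Ico_add' (fun i => (1 - t ^ i) / (1 - t)) 0 n 1]
  rfl

theorem vLam_eq_prod_qFactorial (hN : ∀ i, lam i ≤ N) (ht : t ≠ 1) :
    vLam lam t = ∏ j : Fin (N + 1), qFactorial t (mult lam j) := by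
  rw [Fin.prod_univ_eq_prod_range (fun j => qFactorial t (mult lam j)) (N + 1), vLam]
  simp only [vNum_eq_qFactorial ht]
  refine Finset.prod_subset (fun j hj => ?_) fun j _ hj => ?_
  · obtain ⟨i, -, rfl⟩ := Finset.mem_image.mp hj
    exact Finset.mem_range.mpr (Nat.lt_succ_of_le (hN i))
  · have hmult : mult lam j = 0 := mult_eq_zero_iff.mpr fun i hi =>
      hj (Finset.mem_image.mpr ⟨i, Finset.mem_univ i, hi⟩)
    rw [hmult, qFactorial, Finset.prod_range_zero]

theorem ZR_eq_vLam_mul_ZP (hN : ∀ i, lam i ≤ N) (ht : t ≠ 1) (ht' : ∀ n, qFactorial t n ≠ 0)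
    (z : Fin r → K) : ZR N lam z t = vLam lam t * ZP N lam z t := by
  rw [ZR, ZP, partitionFunction, partitionFunction, mul_finsum, vLam_eq_prod_qFactorial hN ht]
  exact finsum_congr fun s => s.weight_weightR ht' z

end GaugeTransformation

section BaseChange

variable {A B : Type*} [CommRing A] [CommRing B] (φ : A →+* B) {r : ℕ} (N : ℕ) (lam : Fin r → ℕ)
  (z : Fin r → A) (t : A)

theorem map_partitionFunction {w : A → HSpin → ℕ → HSpin → ℕ → A}
    {w' : B → HSpin → ℕ → HSpin → ℕ → B}
    (hw : (Function.support fun s : State r N lam => s.weight w z).Finite)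
    (hφ : ∀ x a b c d, φ (w x a b c d) = w' (φ x) a b c d) :
    φ (partitionFunction N lam w z) = partitionFunction N lam w' fun i => φ (z i) := by
  rw [partitionFunction, partitionFunction, map_finsum φ hw]
  simp only [State.weight, map_prod, hφ]

theorem map_ZP : φ (ZP N lam z t) = ZP N lam (fun i => φ (z i)) (φ t) := by
  refine map_partitionFunction φ N lam z (finite_support_weightP z t) fun x a b c d => ?_
  cases a <;> cases c <;> simp [weightP, apply_ite φ]

theorem map_ZR : φ (ZR N lam z t) = ZR N lam (fun i => φ (z i)) (φ t) := by
  refine map_partitionFunction φ N lam z (finite_support_weightR z t) fun x a b c d => ?_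
  cases a <;> cases c <;> simp [weightR, qInt, apply_ite φ]

end BaseChange

section RatField

variable {r N : ℕ} {lam : Fin r → ℕ}

theorem genZ_injective (r : ℕ) : Function.Injective (genZ r) :=
  (FaithfulSMul.algebraMap_injective _ _).comp MvPolynomial.X_injective

theorem genT_pow_ne_one (r : ℕ) {n : ℕ} (hn : n ≠ 0) : genT r ^ n ≠ 1 := by
  rw [genT, ← map_pow, ← map_pow, ← map_one (algebraMap (MvPolynomial (Fin r) (Polynomial ℤ)) _),
    ← map_one MvPolynomial.C]
  intro h
  have hdeg := congrArg Polynomial.natDegree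
    (MvPolynomial.C_injective _ _ (FaithfulSMul.algebraMap_injective _ _ h))
  simp [hn] at hdeg

theorem genT_ne_one (r : ℕ) : genT r ≠ 1 := by
  simpa only [pow_one] using genT_pow_ne_one r one_ne_zero

theorem qFactorial_genT_ne_zero (r n : ℕ) : qFactorial (genT r) n ≠ 0 := by
  refine Finset.prod_ne_zero_iff.mpr fun i _ => ?_
  rw [qInt_eq_div (genT_ne_one r)]
  exact div_ne_zero (sub_ne_zero.mpr (genT_pow_ne_one r i.succ_ne_zero).symm)
    (sub_ne_zero.mpr (genT_ne_one r).symm)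

theorem vLam_genT_ne_zero (lam : Fin r → ℕ) : vLam lam (genT r) ≠ 0 :=
  Finset.prod_ne_zero_iff.mpr fun j _ => by
    rw [vNum_eq_qFactorial (genT_ne_one r)]
    exact qFactorial_genT_ne_zero r _

theorem ZR_eq_hallLittlewoodR (hlam : Antitone lam) (hN : ∀ i, lam i ≤ N) :
    ZR N lam (genZ r) (genT r) = hallLittlewoodR lam :=
  ZR_eq_hallLittlewoodSum hlam hN (genZ_injective r)

theorem ZP_eq_hallLittlewoodP (hlam : Antitone lam) (hN : ∀ i, lam i ≤ N) :
    ZP N lam (genZ r) (genT r) = hallLittlewoodP lam := by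
  rw [hallLittlewoodP, ← ZR_eq_hallLittlewoodR hlam hN,
    ZR_eq_vLam_mul_ZP hN (genT_ne_one r) (qFactorial_genT_ne_zero r),
    inv_mul_cancel_left₀ (vLam_genT_ne_zero lam)]

theorem ZP_eq_evalAt {K : Type*} [CommRing K] (N : ℕ) (lam : Fin r → ℕ) (z : Fin r → K) (t : K) :
    ZP N lam z t = evalAt z t (ZP N lam MvPolynomial.X (MvPolynomial.C Polynomial.X)) := by
  have h := map_ZP (MvPolynomial.eval₂Hom (Polynomial.eval₂RingHom (Int.castRingHom K) t) z)
    N lam MvPolynomial.X (MvPolynomial.C Polynomial.X)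
  simp only [MvPolynomial.eval₂Hom_X', MvPolynomial.eval₂Hom_C, Polynomial.coe_eval₂RingHom,
    Polynomial.eval₂_X] at h
  exact h.symm

theorem ZR_eq_evalAt {K : Type*} [CommRing K] (N : ℕ) (lam : Fin r → ℕ) (z : Fin r → K) (t : K) :
    ZR N lam z t = evalAt z t (ZR N lam MvPolynomial.X (MvPolynomial.C Polynomial.X)) := by
  have h := map_ZR (MvPolynomial.eval₂Hom (Polynomial.eval₂RingHom (Int.castRingHom K) t) z)
    N lam MvPolynomial.X (MvPolynomial.C Polynomial.X)
  simp only [MvPolynomial.eval₂Hom_X', MvPolynomial.eval₂Hom_C, Polynomial.coe_eval₂RingHom,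
    Polynomial.eval₂_X] at h
  exact h.symm

end RatField

end BosonicModel

open BosonicModel in
theorem mainTheorem7 (r N : ℕ) (lam : Fin r → ℕ) (hlam : Antitone lam)
    (hN : ∀ i, lam i ≤ N) :
    -- the identities in the field of rational functions in the `z_i` and `t`
    (ZP N lam (genZ r) (genT r) = hallLittlewoodP lam ∧
      ZR N lam (genZ r) (genT r) = hallLittlewoodR lam) ∧
    -- `P_lam` and `R_lam` are polynomials, and the identities hold at all values of `z` and `t`
    ∃ P R : MvPolynomial (Fin r) (Polynomial ℤ),
      algebraMap _ (RatField r) P = hallLittlewoodP lam ∧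
      algebraMap _ (RatField r) R = hallLittlewoodR lam ∧
      ∀ (K : Type*) [CommRing K] (z : Fin r → K) (t : K),
        ZP N lam z t = evalAt z t P ∧ ZR N lam z t = evalAt z t R := by
  have hP : ZP N lam (genZ r) (genT r) = hallLittlewoodP lam := ZP_eq_hallLittlewoodP hlam hN
  have hR : ZR N lam (genZ r) (genT r) = hallLittlewoodR lam := ZR_eq_hallLittlewoodR hlam hN
  exact ⟨⟨hP, hR⟩, ZP N lam MvPolynomial.X (MvPolynomial.C Polynomial.X),
    ZR N lam MvPolynomial.X (MvPolynomial.C Polynomial.X),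
    (map_ZP _ N lam _ _).trans hP, (map_ZR _ N lam _ _).trans hR,
    fun _ _ z t => ⟨ZP_eq_evalAt N lam z t, ZR_eq_evalAt N lam z t⟩⟩
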